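/- Let $\mathbb K$ be an algebraically closed field of characteristic zero, and let $p_1,\dots,p_k\in\mathbb K[x_1,\dots,x_n]$ be irreducible polynomials that are (jointly) algebraically independent over $\mathbb K$. Let $m_1,\dots,m_k$ be non-negative integers with $\gcd(m_1,\dots,m_k)=1$. Then the polynomial $p_1^{m_1}p_2^{m_2}\cdots p_k^{m_k}+\lambda$ is irreducible in $\mathbb K[x_1,\dots,x_n]$ for all but finitely many $\lambda\in\mathbb K$. -/

import Mathlib

/-! Write `f = ∏ pᵢ ^ mᵢ`. The proof has two halves. `K[f]` is integrally closed in the polynomial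
ring: by Gordan its integral closure is some `K[a]`, so `f = h(a)`. For each root `α` of `h`, `a -
α` divides `f`, hence is a constant times a monomial in the `pᵢ`. Two distinct roots would give
nonconstant monomials differing by a nonzero constant, against algebraic independence. So `f` is a
constant times `(a - α) ^ d`; then `d` divides every `mᵢ`, so `d = 1` and `K[a] = K[f]`. Bertini:
suppose `f + c = g_c h_c` properly for infinitely many `c`. Then `df ∧ dg_c = g_c (dh_c ∧ dg_c)`,
and the forms `dh_c ∧ dg_c` have bounded degree, so they are linearly dependent. The same
combination `ω = ∑ α_c dg_c / g_c` satisfies `df ∧ ω = 0`. As `ω` is closed, `ω = q df` with `dq ∧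
df = 0`, so `q` is algebraic over `K(f)` and, by the first half, `q = u(f) / v(f)`. Such a form has
poles along all of `f + c` or none of it, while `ω` has a pole along `g_c` (if `α_c ≠ 0`) but none
along `h_c`. -/

/-! ### Derivations and algebraic dependence. -/

/-- In characteristic zero, an element transcendental over a subring is not killed by every
derivation over that subring. -/
theorem Transcendental.exists_derivation_eq_one {F E : Type*} [CommRing F] [IsDomain F] [Field E]
    [CharZero E] [Algebra F E] [FaithfulSMul F E] {q : E} (hq : Transcendental F q) :
    ∃ D : Derivation F E E, D q = 1 := by
  classical
  have hs : AlgebraicIndepOn F id {q} := by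
    have := (algebraicIndependent_unique_type_iff (R := F) (ι := ({q} : Set E))
      (x := fun i => id (i : E))).2 (by simpa using hq)
    exact this
  obtain ⟨B, hqB, hB⟩ := exists_isTranscendenceBasis_superset hs
  let v : B → E := Subtype.val
  have hv : AlgebraicIndependent F v := hB.1
  let S := Algebra.adjoin F (Set.range v)
  have halg : Algebra.IsAlgebraic S E := hB.isAlgebraic
  let _ : Algebra (FractionRing S) E := FractionRing.liftAlgebra S E
  have : IsScalarTower S (FractionRing S) E := inferInstance
  have : Algebra.IsAlgebraic (FractionRing S) E :=
    (IsFractionRing.comap_isAlgebraic_iff (A := S)).1 halg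
  have : CharZero (FractionRing S) := (algebraMap (FractionRing S) E).charZero
  -- Localizations and, in characteristic zero, algebraic field extensions are formally étale, so
  -- the derivation `∂/∂q` of the polynomial ring `S` extends to `E`.
  have h1 : Algebra.FormallyEtale S (FractionRing S) := .of_isLocalization (nonZeroDivisors S)
  have h2 : Algebra.FormallyEtale (FractionRing S) E := Algebra.FormallyEtale.of_isSeparable _ E
  have h3 : Algebra.FormallyEtale S E := .comp _ (FractionRing S) _
  let d : Derivation F S E := Derivation.mk'
    ((MvPolynomial.aeval v).toLinearMap ∘ₗ
      (MvPolynomial.pderiv (⟨q, hqB rfl⟩ : B)).toLinearMap ∘ₗ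
        hv.aevalEquiv.symm.toLinearMap) (by
    intro a b
    have key : ∀ c : S, MvPolynomial.aeval v (hv.aevalEquiv.symm c) = (c : E) := fun c => by
      rw [← hv.algebraMap_aevalEquiv, AlgEquiv.apply_symm_apply]
      rfl
    simp only [LinearMap.comp_apply, AlgEquiv.toLinearMap_apply, map_mul, AlgHom.toLinearMap_apply,
      Derivation.coeFn_coe, Derivation.leibniz, map_add, smul_eq_mul, key]
    rfl)
  have hbc := KaehlerDifferential.isBaseChange_of_formallyEtale F S E
  let L : Ω[E⁄F] →ₗ[E] E := hbc.lift d.liftKaehlerDifferential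
  refine ⟨L.compDer (KaehlerDifferential.D F E), ?_⟩
  let s : S := ⟨q, Algebra.subset_adjoin ⟨⟨q, hqB rfl⟩, rfl⟩⟩
  have hsx : hv.aevalEquiv (MvPolynomial.X ⟨q, hqB rfl⟩) = s := by
    apply Subtype.ext
    have := hv.algebraMap_aevalEquiv (MvPolynomial.X ⟨q, hqB rfl⟩)
    rw [MvPolynomial.aeval_X] at this
    exact this
  have : L (KaehlerDifferential.map F F S E (KaehlerDifferential.D F S s)) = d s := by
    rw [hbc.lift_eq]; simp
  rw [KaehlerDifferential.map_D] at this
  refine this.trans ?_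
  have : d s = MvPolynomial.aeval v (MvPolynomial.pderiv (⟨q, hqB rfl⟩ : B)
    (hv.aevalEquiv.symm s)) := rfl
  rw [this, ← hsx, AlgEquiv.symm_apply_apply, MvPolynomial.pderiv_X_self, map_one]

namespace MvPolynomial

variable {σ K : Type*} [Field K]

theorem pderiv_comm (i j : σ) (f : MvPolynomial σ K) :
    pderiv i (pderiv j f) = pderiv j (pderiv i f) := by
  classical
  let D (i : σ) : Derivation K (MvPolynomial σ K) (MvPolynomial σ K) := pderiv i
  have : ⁅D i, D j⁆ = 0 := by
    apply MvPolynomial.derivation_ext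
    intro k
    simp [D, Derivation.commutator_apply, pderiv_X, Pi.single_apply, apply_ite]
  have := congrArg (fun D' : Derivation K (MvPolynomial σ K) (MvPolynomial σ K) => D' f) this
  simpa [D, Derivation.commutator_apply, sub_eq_zero] using this

theorem exists_pderiv_ne_zero [CharZero K] {f : MvPolynomial σ K} (hf : ∀ c, f ≠ C c) :
    ∃ i, pderiv i f ≠ 0 := by
  classical
  by_contra! h
  apply hf (coeff 0 f)
  ext m
  rw [coeff_C]
  split_ifs with hm
  · rw [hm]
  · have : ∃ i, m i ≠ 0 := by
      by_contra! h0
      exact hm (Finsupp.ext fun i => (h0 i).symm)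
    obtain ⟨i, hi⟩ := this
    have h1 := coeff_pderiv (i := i) f (m - Finsupp.single i 1)
    have h2 : m - Finsupp.single i 1 + Finsupp.single i 1 = m := by
      ext k
      by_cases hk : i = k
      · subst hk; simp; omega
      · simp [hk]
    rw [h, h2, coeff_zero] at h1
    have h3 : (((m - Finsupp.single i 1 : σ →₀ ℕ) i : K) + 1) ≠ 0 := Nat.cast_add_one_ne_zero _
    rcases mul_eq_zero.1 h1.symm with h4 | h4
    · exact h4
    · exact absurd h4 h3

theorem derivation_algebraMap_eq_sum {E : Type*} [Field E] [Algebra (MvPolynomial σ K) E]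
    [Algebra K E] [IsScalarTower K (MvPolynomial σ K) E] [Fintype σ]
    (D : Derivation K E E) (a : MvPolynomial σ K) :
    D (algebraMap (MvPolynomial σ K) E a) = ∑ j, D (algebraMap (MvPolynomial σ K) E (X j)) * algebraMap _ E (pderiv j a) := by
  classical
  induction a using MvPolynomial.induction_on with
  | C c =>
    have : algebraMap (MvPolynomial σ K) E (C c) = algebraMap K E c :=
      (IsScalarTower.algebraMap_apply K (MvPolynomial σ K) E c).symm
    simp [this]
  | add a b ha hb => simp [ha, hb, mul_add, Finset.sum_add_distrib]
  | mul_X a i ha =>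
    simp only [map_mul, Derivation.leibniz, smul_eq_mul, ha, map_add, pderiv_X, mul_add,
      Finset.sum_add_distrib]
    congr 1
    · rw [Finset.sum_eq_single i]
      · simp [mul_comm]
      · intro j _ hj; simp [hj]
      · simp
    · rw [Finset.mul_sum]
      exact Finset.sum_congr rfl fun j _ => by ring

/-- If the differential of `a / b` is proportional to the differential of `f`, then `a / b` is
algebraic over `K[f]`. -/
theorem isAlgebraic_div_of_pderiv_proportional [CharZero K] [Fintype σ] {E : Type*} [Field E]
    [Algebra (MvPolynomial σ K) E] [IsFractionRing (MvPolynomial σ K) E]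
    {f a b : MvPolynomial σ K} {i₀ : σ} (hf : pderiv i₀ f ≠ 0) (hb : b ≠ 0)
    (h : ∀ i, pderiv i₀ f * (b * pderiv i a - a * pderiv i b) =
      pderiv i f * (b * pderiv i₀ a - a * pderiv i₀ b)) :
    IsAlgebraic (Algebra.adjoin K {f}) (algebraMap _ E a / algebraMap _ E b) := by
  by_contra hq
  let R := MvPolynomial σ K
  let _ : Algebra K E := ((algebraMap R E).comp (algebraMap K R)).toAlgebra
  have : IsScalarTower K R E := .of_algebraMap_eq fun _ => rfl
  have : IsScalarTower K (Algebra.adjoin K {f}) E := .of_algebraMap_eq fun _ => rfl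
  have hinj : Function.Injective (algebraMap R E) := IsFractionRing.injective _ _
  have : CharZero E := charZero_of_injective_algebraMap (algebraMap K E).injective
  have : FaithfulSMul (Algebra.adjoin K {f}) E := by
    rw [faithfulSMul_iff_algebraMap_injective]
    exact hinj.comp Subtype.val_injective
  obtain ⟨D', hD'⟩ := Transcendental.exists_derivation_eq_one (F := Algebra.adjoin K {f}) hq
  let D : Derivation K E E := D'.restrictScalars K
  have hDf : D (algebraMap R E f) = 0 :=
    D'.map_algebraMap ⟨f, Algebra.subset_adjoin rfl⟩
  have hb' : algebraMap R E b ≠ 0 := (map_ne_zero_iff _ hinj).2 hb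
  have hDq : algebraMap R E b * D (algebraMap R E a) - algebraMap R E a * D (algebraMap R E b) =
      algebraMap R E b ^ 2 := by
    have h1 : D (algebraMap R E a / algebraMap R E b) = 1 := hD'
    rw [Derivation.leibniz_div] at h1
    simp only [smul_eq_mul] at h1
    field_simp at h1
    linear_combination h1
  rw [derivation_algebraMap_eq_sum] at hDf
  rw [derivation_algebraMap_eq_sum, derivation_algebraMap_eq_sum, Finset.mul_sum,
    Finset.mul_sum, ← Finset.sum_sub_distrib] at hDq
  -- Proportionality turns `∂f/∂x_{i₀}` times `b² D(a/b)` into a multiple of `D f = 0`.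
  have key : algebraMap R E (pderiv i₀ f) * algebraMap R E b ^ 2 = 0 := by
    rw [← hDq, Finset.mul_sum]
    calc _ = ∑ j, algebraMap R E (b * pderiv i₀ a - a * pderiv i₀ b) *
          (D (algebraMap R E (X j)) * algebraMap R E (pderiv j f)) := by
          refine Finset.sum_congr rfl fun j _ => ?_
          have := congrArg (algebraMap R E) (h j)
          simp only [map_mul, map_sub] at this ⊢
          linear_combination D (algebraMap R E (X j)) * this
      _ = 0 := by rw [← Finset.mul_sum, hDf, mul_zero]
  rcases mul_eq_zero.1 key with h1 | h1
  · exact hf ((map_eq_zero_iff _ hinj).1 h1)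
  · exact hb' (pow_eq_zero_iff two_ne_zero |>.1 h1)

end MvPolynomial

/-! ### Lüroth's theorem for subalgebras of `K[X]`. -/

namespace Polynomial

variable {K : Type*} [Field K]

/-- If `m` is the monic multiple of `u`, then `X` is a root of `m(T) - m`, which is monic in `T`
with coefficients in `S`. -/
theorem isIntegral_of_mem_of_natDegree_pos (S : Subalgebra K K[X]) {u : K[X]} (hu : u ∈ S)
    (hd : 0 < u.natDegree) (p : K[X]) : IsIntegral S p := by
  have hu0 : u ≠ 0 := by rintro rfl; simp at hd
  have hX : IsIntegral S (X : K[X]) := by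
    let m : K[X] := u * C u.leadingCoeff⁻¹
    have hm : m.Monic := monic_mul_leadingCoeff_inv hu0
    have hmd : m.natDegree = u.natDegree :=
      natDegree_mul_C (inv_ne_zero (leadingCoeff_ne_zero.2 hu0))
    have hmS : m ∈ S := S.mul_mem hu (S.algebraMap_mem _)
    refine ⟨m.map (algebraMap K S) - C ⟨m, hmS⟩, (hm.map _).sub_of_left ?_, ?_⟩
    · refine degree_C_le.trans_lt ?_
      rw [hm.degree_map, ← natDegree_pos_iff_degree_pos, hmd]
      exact hd
    · rw [eval₂_sub, eval₂_map, eval₂_C, ← IsScalarTower.algebraMap_eq K S K[X], sub_eq_zero]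
      change eval₂ C X m = m
      exact eval₂_C_X
  have hC : ∀ c : K, IsIntegral S (C c : K[X]) := fun c =>
    isIntegral_algebraMap (x := algebraMap K S c)
  induction p using Polynomial.induction_on' with
  | add p q hp hq => exact hp.add hq
  | monomial n a =>
    rw [← C_mul_X_pow_eq_monomial]
    exact (hC a).mul (hX.pow n)

open scoped IntermediateField.algebraAdjoinAdjoin in
/-- **Lüroth's theorem for polynomials**: an integrally closed subalgebra of `K[X]` containing a
nonconstant polynomial is generated by one polynomial. -/
theorem exists_eq_adjoin_of_isIntegrallyClosed (A : Subalgebra K K[X]) [IsIntegrallyClosed A]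
    {f : K[X]} (hf : f ∈ A) (hd : 0 < f.natDegree) : ∃ u ∈ A, A = Algebra.adjoin K {u} := by
  let ι : K[X] →ₐ[K] RatFunc K := IsScalarTower.toAlgHom K K[X] (RatFunc K)
  have hι : Function.Injective ι := RatFunc.algebraMap_injective K
  let g : A →ₐ[K] RatFunc K := ι.comp A.val
  have hg : Function.Injective g := hι.comp Subtype.val_injective
  let ψ : FractionRing A →ₐ[K] RatFunc K := IsFractionRing.liftAlgHom hg
  have hψ : ∀ a : A, ψ (algebraMap A _ a) = ι a := fun a => IsFractionRing.lift_algebraMap hg a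
  let E : IntermediateField K (RatFunc K) := ψ.fieldRange
  have hAE : ∀ a : A, ι a ∈ E := fun a => ⟨algebraMap A _ a, hψ a⟩
  have hnc : ∀ p : K[X], 0 < p.natDegree → ∀ c, ι p ≠ RatFunc.C c := by
    intro p hp c h
    have : p = C c := hι (h.trans (RatFunc.algebraMap_C c).symm)
    rw [this, natDegree_C] at hp
    exact lt_irrefl _ hp
  have hE : E ≠ ⊥ := by
    intro h
    have h1 := hAE ⟨f, hf⟩
    rw [h] at h1
    obtain ⟨c, hc⟩ := h1
    exact hnc f hd c hc.symm
  let e := RatFunc.Luroth.generator E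
  -- The Lüroth generator is a coefficient of the minimal polynomial of `X`. Since `X` is integral
  -- over `A`, so is `e`, which therefore lies in `A`.
  obtain ⟨i, hi⟩ : ∃ i, e = ((minpoly E (RatFunc.X : RatFunc K)).coeff i : RatFunc K) :=
    ⟨_, dif_neg hE⟩
  let _ : Algebra A E := (g.codRestrict E.toSubalgebra hAE).toRingHom.toAlgebra
  have : IsScalarTower A E (RatFunc K) := .of_algebraMap_eq fun _ => rfl
  have hint : IsIntegral A e := by
    obtain ⟨P, hP, hPX⟩ := isIntegral_of_mem_of_natDegree_pos A hf hd X
    have hdvd : minpoly E (RatFunc.X : RatFunc K) ∣ P.map (algebraMap A E) := by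
      apply minpoly.dvd
      rw [aeval_map_algebraMap, aeval_def]
      have := congrArg ι hPX
      rw [map_zero] at this
      rw [← this]
      have h2 := hom_eval₂ P (algebraMap A K[X]) (ι : K[X] →+* RatFunc K) X
      refine Eq.trans ?_ h2.symm
      congr 1
    have hmon := minpoly.monic
      (RatFunc.IntermediateField.isAlgebraic_X hE).isIntegral
    have hl := integralClosure.mem_lifts_of_monic_of_dvd_map E hP hmon hdvd
    obtain ⟨c, hc⟩ := (lifts_iff_coeff_lifts _).1 hl i
    have h3 : IsIntegral A ((minpoly E (RatFunc.X : RatFunc K)).coeff i) := by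
      rw [← hc]; exact c.2
    rw [hi]
    exact h3.algebraMap
  obtain ⟨v, hv⟩ : e ∈ E := RatFunc.Luroth.generator_mem
  have hvint : IsIntegral A v := by
    let ψ' : FractionRing A →ₐ[A] RatFunc K := { ψ with commutes' := hψ }
    rw [← isIntegral_algHom_iff ψ' ψ.injective]
    change IsIntegral A (ψ v)
    have : ψ v = e := hv
    rwa [this]
  obtain ⟨u, rfl⟩ := IsIntegrallyClosed.isIntegral_iff.1 hvint
  have hu : ι u = e := (hψ u).symm.trans hv
  refine ⟨u, u.2, le_antisymm ?_ (Algebra.adjoin_le (by simp))⟩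
  have hud : 0 < (u : K[X]).natDegree := by
    rw [Nat.pos_iff_ne_zero]
    intro h0
    apply RatFunc.Luroth.generator_ne_C hE
    refine ⟨(u : K[X]).coeff 0, hu.symm.trans ?_⟩
    rw [eq_C_of_natDegree_eq_zero h0]
    simp [ι]
  intro r hr
  -- `r` lies in `K(e)` and is integral over `K[e]`, which is integrally closed because `e` is
  -- transcendental.
  have hrE : ι r ∈ IntermediateField.adjoin K {e} := by
    rw [← RatFunc.Luroth.eq_adjoin_generator]; exact hAE ⟨r, hr⟩
  have htr : Transcendental K e := RatFunc.Luroth.transcendental_generator hE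
  have := Transcendental.uniqueFactorizationMonoid_adjoin K htr
  have : IsIntegrallyClosed (Algebra.adjoin K {e}) :=
    UniqueFactorizationMonoid.instIsIntegrallyClosed
  have hmap : (Algebra.adjoin K {(u : K[X])}).map ι = Algebra.adjoin K {e} := by
    rw [AlgHom.map_adjoin, Set.image_singleton, hu]
  let φ : Algebra.adjoin K {(u : K[X])} →ₐ[K] Algebra.adjoin K {e} :=
    (ι.comp (Subalgebra.val _)).codRestrict _ fun x => hmap ▸ ⟨x, x.2, rfl⟩
  have hrint : IsIntegral (Algebra.adjoin K {e}) (ι r) :=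
    (isIntegral_of_mem_of_natDegree_pos (Algebra.adjoin K {(u : K[X])})
      (Algebra.subset_adjoin rfl) hud r).map_of_comp_eq
      φ.toRingHom ι.toRingHom rfl
  have hrint' : IsIntegral (Algebra.adjoin K {e})
      (⟨ι r, hrE⟩ : IntermediateField.adjoin K {e}) :=
    (isIntegral_algHom_iff (IsScalarTower.toAlgHom (Algebra.adjoin K {e})
      (IntermediateField.adjoin K {e}) (RatFunc K)) Subtype.val_injective).1 hrint
  obtain ⟨y, hy⟩ := IsIntegrallyClosed.isIntegral_iff.1 hrint'
  have hy' : (y : RatFunc K) = ι r := congrArg Subtype.val hy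
  have := y.2
  rw [hy', ← hmap] at this
  obtain ⟨r', hr', h⟩ := this
  rwa [← hι h]

end Polynomial

/-! ### Gordan's theorem, by restriction to a line. -/

namespace MvPolynomial

variable {σ K : Type*} [Field K]

/-- Restrict `f` to the line through two points where its values differ. -/
theorem exists_aeval_natDegree_pos [Infinite K] {f : MvPolynomial σ K} (hf : ∀ c, f ≠ C c) :
    ∃ φ : MvPolynomial σ K →ₐ[K] Polynomial K, 0 < (φ f).natDegree := by
  obtain ⟨x, y, hxy⟩ : ∃ x y, eval x f ≠ eval y f := by
    by_contra! h
    exact hf (eval 0 f) (MvPolynomial.funext fun x => by rw [eval_C]; exact h x 0)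
  let φ : MvPolynomial σ K →ₐ[K] Polynomial K :=
    aeval fun i => Polynomial.C (x i) + Polynomial.X * Polynomial.C (y i - x i)
  have hφ : ∀ t : K, (φ f).eval t = eval (fun i => x i + t * (y i - x i)) f := by
    intro t
    have : (Polynomial.aeval t).comp φ = aeval (fun i => x i + t * (y i - x i)) := by
      ext i; simp [φ]
    have := congrArg (fun g : MvPolynomial σ K →ₐ[K] K => g f) this
    simpa [aeval_eq_eval] using this
  refine ⟨φ, Nat.pos_of_ne_zero fun h0 => hxy ?_⟩
  have h1 := hφ 0
  have h2 := hφ 1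
  rw [Polynomial.eq_C_of_natDegree_eq_zero h0, Polynomial.eval_C] at h1 h2
  simp only [zero_mul, add_zero] at h1
  simp only [one_mul, add_sub_cancel] at h2
  exact h1.symm.trans h2

/-- **Gordan's theorem**: the integral closure of `K[f]` in the polynomial ring is generated by one
polynomial. -/
theorem exists_integralClosure_adjoin_eq [Infinite K] {f : MvPolynomial σ K}
    (hf : ∀ c, f ≠ C c) :
    ∃ a : MvPolynomial σ K, ∀ r, IsIntegral (Algebra.adjoin K {f}) r ↔ r ∈ Algebra.adjoin K {a} := by
  obtain ⟨φ, hφ⟩ := exists_aeval_natDegree_pos hf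
  let S := Algebra.adjoin K {f}
  let A : Subalgebra K (MvPolynomial σ K) := (integralClosure S (MvPolynomial σ K)).restrictScalars K
  have hfA : f ∈ A := isIntegral_algebraMap (x := (⟨f, Algebra.subset_adjoin rfl⟩ : S))
  have hAic : IsIntegrallyClosed A :=
    IsIntegrallyClosed.of_isIntegrallyClosed_of_isIntegrallyClosedIn
      (integralClosure S (MvPolynomial σ K)) (MvPolynomial σ K)
  let g : A →ₐ[K] Polynomial K := φ.comp A.val
  -- A nonzero element integral over `K[f]` divides some nonzero `P(f)`, and `P(φ f) ≠ 0` because `φ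
  -- f` is nonconstant.
  have hg : Function.Injective g := by
    rw [injective_iff_map_eq_zero]
    intro a ha
    by_contra h0
    have ha0 : (a : MvPolynomial σ K) ≠ 0 := fun h => h0 (Subtype.ext h)
    have hai : IsIntegral S (a : MvPolynomial σ K) := a.2
    obtain ⟨c, hc0, b, hb⟩ := hai.isAlgebraic.exists_nonzero_dvd (mem_nonZeroDivisors_of_ne_zero ha0)
    have hc : φ c = 0 := by
      have h1 : (c : MvPolynomial σ K) = a * b := hb
      have h2 : φ a = 0 := ha
      rw [h1, map_mul, h2, zero_mul]
    have hcS : (c : MvPolynomial σ K) ∈ Algebra.adjoin K {f} := c.2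
    rw [Algebra.adjoin_singleton_eq_range_aeval] at hcS
    obtain ⟨P, hP⟩ := hcS
    have hP' : Polynomial.aeval f P = (c : MvPolynomial σ K) := hP
    rw [← hP', ← Polynomial.aeval_algHom_apply] at hc
    have hP0 : P ≠ 0 := by
      rintro rfl
      rw [map_zero] at hP'
      exact hc0 (Subtype.ext hP'.symm)
    have : P.comp (φ f) = 0 := hc
    rcases Polynomial.comp_eq_zero_iff.1 this with h | ⟨_, h⟩
    · exact hP0 h
    · rw [h, Polynomial.natDegree_C] at hφ
      exact lt_irrefl _ hφ
  have hric : IsIntegrallyClosed g.range :=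
    .of_equiv (AlgEquiv.ofInjective g hg).toRingEquiv
  obtain ⟨u, ⟨a, rfl⟩, hu⟩ := Polynomial.exists_eq_adjoin_of_isIntegrallyClosed g.range
    ⟨⟨f, hfA⟩, rfl⟩ hφ
  have hAa : A = Algebra.adjoin K {(a : MvPolynomial σ K)} := by
    apply le_antisymm
    · intro r hr
      have h1 : g ⟨r, hr⟩ ∈ Algebra.adjoin K {g a} := hu ▸ ⟨⟨r, hr⟩, rfl⟩
      rw [← Set.image_singleton, ← AlgHom.map_adjoin] at h1
      obtain ⟨r', hr', h⟩ := h1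
      have h2 : r' = ⟨r, hr⟩ := hg h
      have h3 : A.val r' ∈ (Algebra.adjoin K {a}).map A.val := ⟨r', hr', rfl⟩
      rw [AlgHom.map_adjoin, Set.image_singleton, h2] at h3
      exact h3
    · exact Algebra.adjoin_le (by simp)
  exact ⟨a, fun r => by rw [← hAa]; rfl⟩

end MvPolynomial

/-! ### Primitive monomials in independent irreducibles. -/

namespace MvPolynomial

variable {σ K : Type*} [Field K]

/-- Divisors of a product of powers of irreducible polynomials. -/
theorem exists_eq_C_mul_prod_pow_of_dvd {ι : Type*} {p : ι → MvPolynomial σ K}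
    (hp : ∀ i, Irreducible (p i)) (s : Finset ι) (m : ι → ℕ) {d : MvPolynomial σ K}
    (hd : d ∣ ∏ i ∈ s, p i ^ m i) :
    ∃ (c : K) (e : ι → ℕ), c ≠ 0 ∧ d = C c * ∏ i ∈ s, p i ^ e i := by
  classical
  induction s using Finset.induction_on generalizing d with
  | empty =>
    rw [Finset.prod_empty] at hd
    obtain ⟨c, hc, h⟩ := isUnit_iff_eq_C_of_isReduced.1 (isUnit_of_dvd_one hd)
    exact ⟨c, 0, hc.ne_zero, by simp [h]⟩
  | insert i s hi ih =>
    rw [Finset.prod_insert hi] at hd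
    obtain ⟨d₁, d₂, h₁, h₂, rfl⟩ := exists_dvd_and_dvd_of_dvd_mul hd
    obtain ⟨c, e, hc, he⟩ := ih h₂
    obtain ⟨j, -, hj⟩ := (dvd_prime_pow (hp i).prime _).1 h₁
    obtain ⟨w, hw⟩ := hj.symm
    obtain ⟨b, hb, h⟩ := isUnit_iff_eq_C_of_isReduced.1 w.isUnit
    refine ⟨b * c, Function.update e i j, mul_ne_zero hb.ne_zero hc, ?_⟩
    have : ∏ x ∈ s, p x ^ Function.update e i j x = ∏ x ∈ s, p x ^ e x :=
      Finset.prod_congr rfl fun x hx => by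
        rw [Function.update_of_ne (ne_of_mem_of_not_mem hx hi)]
    rw [Finset.prod_insert hi, Function.update_self, this, he, ← hw, h, C_mul]
    ring

theorem _root_.AlgebraicIndependent.aeval_monomial_eq_prod {ι R : Type*} [Fintype ι]
    [CommRing R] [Algebra K R]
    (p : ι → R) (e : ι → ℕ) (c : K) :
    aeval p (monomial (Finsupp.equivFunOnFinite.symm e) c) = algebraMap K R c * ∏ i, p i ^ e i := by
  rw [aeval_monomial, Finsupp.prod_fintype _ _ (by simp)]
  simp

variable [IsAlgClosed K]

/-- A primitive monomial in algebraically independent irreducible polynomials is not a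
composite polynomial. -/
theorem mem_adjoin_of_isIntegral_adjoin_prod_pow {ι : Type*} [Fintype ι]
    {p : ι → MvPolynomial σ K} {m : ι → ℕ} (hirr : ∀ i, Irreducible (p i))
    (hind : AlgebraicIndependent K p) (hgcd : Finset.univ.gcd m = 1)
    (hf : ∀ c, ∏ i, p i ^ m i ≠ C c)
    {r : MvPolynomial σ K} (hr : IsIntegral (Algebra.adjoin K {∏ i, p i ^ m i}) r) :
    r ∈ Algebra.adjoin K {∏ i, p i ^ m i} := by
  classical
  have : Infinite K := IsAlgClosed.instInfinite
  obtain ⟨a, ha⟩ := exists_integralClosure_adjoin_eq hf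
  have hfa : ∏ i, p i ^ m i ∈ Algebra.adjoin K {a} :=
    (ha _).1 (isIntegral_algebraMap
      (x := (⟨_, Algebra.subset_adjoin rfl⟩ : Algebra.adjoin K {∏ i, p i ^ m i})))
  have hra := (ha r).1 hr
  rw [Algebra.adjoin_singleton_eq_range_aeval] at hfa
  obtain ⟨h, hh⟩ := hfa
  replace hh : Polynomial.aeval a h = ∏ i, p i ^ m i := hh
  have hdvd : ∀ α ∈ h.roots, a - C α ∣ ∏ i, p i ^ m i := by
    intro α hα
    obtain ⟨q, hq⟩ := Polynomial.dvd_iff_isRoot.2 (Polynomial.isRoot_of_mem_roots hα)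
    rw [← hh, hq, map_mul]
    exact ⟨Polynomial.aeval a q, by simp [algebraMap_eq]⟩
  have hform : ∀ α ∈ h.roots, ∃ (c : K) (e : ι → ℕ), c ≠ 0 ∧ a - C α = C c * ∏ i, p i ^ e i :=
    fun α hα => exists_eq_C_mul_prod_pow_of_dvd hirr _ m (hdvd α hα)
  have ha_nc : ∀ c, a ≠ C c := by
    rintro c rfl
    apply hf (h.eval c)
    rw [← hh]
    exact Polynomial.aeval_algebraMap_apply_eq_algebraMap_eval c h
  have hsplit := (IsAlgClosed.splits h).eq_prod_roots
  have hroots : ∀ α ∈ h.roots, ∀ β ∈ h.roots, α = β := by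
    intro α hα β hβ
    obtain ⟨c, e, hc, he⟩ := hform α hα
    obtain ⟨c', e', hc', he'⟩ := hform β hβ
    have h0 : aeval p (monomial (Finsupp.equivFunOnFinite.symm e) c -
        monomial (Finsupp.equivFunOnFinite.symm e') c' - C (β - α)) = 0 := by
      rw [map_sub, map_sub, AlgebraicIndependent.aeval_monomial_eq_prod,
        AlgebraicIndependent.aeval_monomial_eq_prod, aeval_C, algebraMap_eq, ← he, ← he', C_sub]
      ring
    have h1 := (algebraicIndependent_iff.1 hind) _ h0
    have h2 : ∀ (e : ι → ℕ) (c γ : K), a - C γ = C c * ∏ i, p i ^ e i →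
        Finsupp.equivFunOnFinite.symm e ≠ 0 := by
      intro e c γ he h
      have : e = 0 := by
        ext i; exact DFunLike.congr_fun h i
      subst this
      apply ha_nc (γ + c)
      rw [C_add, ← sub_eq_iff_eq_add', he]
      simp
    -- Neither monomial is constant, as `a` is not, so only `β - α` contributes to the constant
    -- term.
    have h3 := congrArg (coeff 0) h1
    rw [coeff_sub, coeff_sub, coeff_monomial, coeff_monomial, if_neg (h2 e c α he),
      if_neg (h2 e' c' β he'), coeff_C, if_pos rfl, coeff_zero] at h3
    linear_combination h3
  have hne : h.roots ≠ 0 := by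
    intro h0
    rw [h0] at hsplit
    apply hf h.leadingCoeff
    rw [← hh, hsplit]
    simp [algebraMap_eq]
  obtain ⟨α, hα⟩ := Multiset.exists_mem_of_ne_zero hne
  have hrep : h.roots = Multiset.replicate (Multiset.card h.roots) α :=
    Multiset.eq_replicate_card.2 fun b hb => hroots b hb α hα
  set d := Multiset.card h.roots with hd
  have hfpow : ∏ i, p i ^ m i = C h.leadingCoeff * (a - C α) ^ d := by
    rw [← hh]
    conv_lhs => rw [hsplit, hrep]
    simp [algebraMap_eq]
  obtain ⟨c, e, hc, he⟩ := hform α hα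
  have hde : ∀ i, m i = d * e i := by
    have h0 : aeval p (monomial (Finsupp.equivFunOnFinite.symm m) (1 : K)) =
        aeval p (monomial (Finsupp.equivFunOnFinite.symm (fun i => d * e i))
          (h.leadingCoeff * c ^ d)) := by
      rw [AlgebraicIndependent.aeval_monomial_eq_prod,
        AlgebraicIndependent.aeval_monomial_eq_prod, map_one, one_mul, hfpow, he, mul_pow,
        ← Finset.prod_pow, map_mul, map_pow, algebraMap_eq, mul_assoc]
      simp only [← pow_mul, mul_comm]
    have h1 := hind h0
    rcases (monomial_eq_monomial_iff _ _ _ _).1 h1 with ⟨h2, _⟩ | ⟨h2, _⟩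
    · intro i
      exact DFunLike.congr_fun h2 i
    · exact absurd h2 one_ne_zero
  have hd1 : d = 1 := by
    rw [← Nat.dvd_one, ← hgcd]
    exact Finset.dvd_gcd fun i _ => ⟨e i, hde i⟩
  have hlc : h.leadingCoeff ≠ 0 := by
    rw [Polynomial.leadingCoeff_ne_zero]
    rintro rfl
    exact hne Polynomial.roots_zero
  have haf : a ∈ Algebra.adjoin K {∏ i, p i ^ m i} := by
    have : a = C h.leadingCoeff⁻¹ * ∏ i, p i ^ m i + C α := by
      rw [hfpow, hd1, pow_one, ← mul_assoc, ← C_mul, inv_mul_cancel₀ hlc]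
      simp
    rw [this]
    exact add_mem (mul_mem (Subalgebra.algebraMap_mem _ _) (Algebra.subset_adjoin rfl))
      (Subalgebra.algebraMap_mem _ _)
  exact (Algebra.adjoin_le (by simpa using haf) : Algebra.adjoin K {a} ≤ _) hra

end MvPolynomial

/-! ### Rational functions of `f` and logarithmic differentials. -/

namespace MvPolynomial

variable {σ K : Type*} [Field K]

/-- Some nonzero `c` in `K[f]` makes `c a / b` integral over `K[f]`; it is then a polynomial, and
lies in `K[f]` by `hcl`. -/
theorem exists_isCoprime_of_isAlgebraic_div {E : Type*} [Field E]
    [Algebra (MvPolynomial σ K) E] [IsFractionRing (MvPolynomial σ K) E]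
    {f a b : MvPolynomial σ K}
    (hcl : ∀ r, IsIntegral (Algebra.adjoin K {f}) r → r ∈ Algebra.adjoin K {f}) (hb : b ≠ 0)
    (h : IsAlgebraic (Algebra.adjoin K {f}) (algebraMap _ E a / algebraMap _ E b)) :
    ∃ u v : Polynomial K, IsCoprime u v ∧
      a * Polynomial.aeval f v = b * Polynomial.aeval f u := by
  classical
  have hinj : Function.Injective (algebraMap (MvPolynomial σ K) E) := IsFractionRing.injective _ _
  obtain ⟨c, hc0, hc⟩ := h.exists_integral_multiple
  have : IsScalarTower (Algebra.adjoin K {f}) (MvPolynomial σ K) E := inferInstance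
  obtain ⟨r, hr⟩ := IsIntegrallyClosed.isIntegral_iff.1 (hc.tower_top (A := MvPolynomial σ K))
  have hrS : r ∈ Algebra.adjoin K {f} := by
    apply hcl
    rw [← hr] at hc
    exact (isIntegral_algHom_iff
      (IsScalarTower.toAlgHom (Algebra.adjoin K {f}) (MvPolynomial σ K) E) hinj).1 hc
  have hrel : r * b = c * a := by
    apply hinj
    have hb' : algebraMap _ E b ≠ 0 := (map_ne_zero_iff _ hinj).2 hb
    rw [map_mul, map_mul, hr, Algebra.smul_def, mul_assoc, div_mul_cancel₀ _ hb']
    rfl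
  have hc0' : (c : MvPolynomial σ K) ≠ 0 := fun h => hc0 (Subtype.ext h)
  rw [Algebra.adjoin_singleton_eq_range_aeval] at hrS
  have hcS : (c : MvPolynomial σ K) ∈ (Polynomial.aeval f).range :=
    (Algebra.adjoin_singleton_eq_range_aeval K f).le c.2
  obtain ⟨u, hu⟩ := hrS
  obtain ⟨v, hv⟩ := hcS
  replace hu : Polynomial.aeval f u = r := hu
  replace hv : Polynomial.aeval f v = c := hv
  obtain ⟨u', v', hu', hv', hg⟩ := extract_gcd u v
  have hu'' := congrArg (Polynomial.aeval f) hu'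
  have hv'' := congrArg (Polynomial.aeval f) hv'
  rw [map_mul] at hu'' hv''
  refine ⟨u', v', (gcd_isUnit_iff _ _).1 hg, ?_⟩
  rw [← hu, ← hv, hu'', hv''] at hrel
  have : Polynomial.aeval f (gcd u v) ≠ 0 := by
    intro h0
    rw [← hv, hv'', h0, zero_mul] at hc0'
    exact hc0' rfl
  apply mul_left_cancel₀ this
  linear_combination -hrel

/-- Such a `g` is one of the finitely many irreducible factors of `∂f/∂xᵢ` up to units, and no
nonunit divides two members of the pencil. -/
theorem finite_setOf_irreducible_dvd_pderiv {f : MvPolynomial σ K} {i : σ}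
    (hf : pderiv i f ≠ 0) :
    {c : K | ∃ g, Irreducible g ∧ g ∣ f + C c ∧ ∀ j, g ∣ pderiv j f}.Finite := by
  classical
  have key : ∀ c ∈ {c : K | ∃ g, Irreducible g ∧ g ∣ f + C c ∧ ∀ j, g ∣ pderiv j f},
      ∃ g ∈ UniqueFactorizationMonoid.factors (pderiv i f), g ∣ f + C c := by
    rintro c ⟨g, hg, hgc, hgd⟩
    obtain ⟨q, hq, hqg⟩ := UniqueFactorizationMonoid.exists_mem_factors_of_dvd hf hg (hgd i)
    exact ⟨q, hq, hqg.symm.dvd.trans hgc⟩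
  choose! G hG hGc using key
  refine Set.Finite.of_injOn (f := G)
    (t := ((UniqueFactorizationMonoid.factors (pderiv i f)).toFinset : Set _)) ?_ ?_
    (Finset.finite_toSet _)
  · intro c hc
    simpa using hG c hc
  · intro c hc c' hc' h
    by_contra hne
    have h1 : G c ∣ C (c - c') := by
      have := dvd_sub (hGc c hc) (h ▸ hGc c' hc')
      rwa [add_sub_add_left_eq_sub, ← C_sub] at this
    have hu : IsUnit (C (c - c') : MvPolynomial σ K) :=
      (isUnit_iff_ne_zero.2 (sub_ne_zero.2 hne)).map C
    exact (UniqueFactorizationMonoid.irreducible_of_factor _ (hG c hc)).not_isUnit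
      (isUnit_of_dvd_unit h1 hu)

theorem totalDegree_pderiv_le (i : σ) (f : MvPolynomial σ K) :
    (pderiv i f).totalDegree ≤ f.totalDegree := by
  classical
  refine Finset.sup_le fun m hm => ?_
  have hm' : m + Finsupp.single i 1 ∈ f.support := by
    rw [mem_support_iff, coeff_pderiv] at hm
    exact mem_support_iff.2 (left_ne_zero_of_mul hm)
  refine le_trans ?_ (le_totalDegree hm')
  rw [Finsupp.sum_add_index' (fun _ => rfl) (fun _ _ _ => rfl)]
  exact Nat.le_add_right _ _

/-- The numerator of `∑ α c • ∂ⱼ(g c) / g c` over the common denominator `∏ g c`. -/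
noncomputable def dlogNum {ι : Type*} [DecidableEq ι] (α : ι → K) (g : ι → MvPolynomial σ K)
    (s : Finset ι) (j : σ) : MvPolynomial σ K :=
  ∑ c ∈ s, C (α c) * pderiv j (g c) * ∏ μ ∈ s.erase c, g μ

section dlogNum

variable {ι : Type*} [DecidableEq ι] (α : ι → K) (g : ι → MvPolynomial σ K)

theorem dlogNum_insert {s : Finset ι} {a : ι} (ha : a ∉ s) (j : σ) :
    dlogNum α g (insert a s) j =
      C (α a) * pderiv j (g a) * ∏ μ ∈ s, g μ + g a * dlogNum α g s j := by
  rw [dlogNum, Finset.sum_insert ha, Finset.erase_insert ha, dlogNum, Finset.mul_sum]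
  congr 1
  refine Finset.sum_congr rfl fun c hc => ?_
  have hca : a ≠ c := fun h => ha (h ▸ hc)
  rw [Finset.erase_insert_of_ne hca, Finset.prod_insert (fun h => ha (Finset.mem_of_mem_erase h))]
  ring

/-- The logarithmic differential form `∑ α c • d(g c) / g c` is closed. -/
theorem dlogNum_closed (s : Finset ι) (i j : σ) :
    (∏ c ∈ s, g c) * pderiv i (dlogNum α g s j) - dlogNum α g s j * pderiv i (∏ c ∈ s, g c) =
      (∏ c ∈ s, g c) * pderiv j (dlogNum α g s i) -
        dlogNum α g s i * pderiv j (∏ c ∈ s, g c) := by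
  induction s using Finset.induction_on with
  | empty => simp [dlogNum]
  | insert a s ha ih =>
    rw [dlogNum_insert α g ha, dlogNum_insert α g ha, Finset.prod_insert ha]
    simp only [map_add, Derivation.leibniz, smul_eq_mul, pderiv_C, mul_zero, add_zero]
    rw [pderiv_comm j i (g a)]
    linear_combination (g a) ^ 2 * ih

theorem dlogNum_proportional {f : MvPolynomial σ K} {k : ι → MvPolynomial σ K} {i j : σ}
    (s : Finset ι) (hk : ∀ c, pderiv i f * pderiv j (g c) - pderiv j f * pderiv i (g c) = k c * g c) :
    pderiv i f * dlogNum α g s j - pderiv j f * dlogNum α g s i =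
      (∑ c ∈ s, α c • k c) * ∏ c ∈ s, g c := by
  rw [dlogNum, dlogNum, Finset.mul_sum, Finset.mul_sum, ← Finset.sum_sub_distrib, Finset.sum_mul]
  refine Finset.sum_congr rfl fun c hc => ?_
  rw [← Finset.mul_prod_erase s g hc, smul_eq_C_mul]
  linear_combination (C (α c) * ∏ μ ∈ s.erase c, g μ) * hk c

/-- Isolates the polar part along `g a`. -/
theorem exists_dlogNum_eq {s : Finset ι} {a : ι} (ha : a ∈ s) (j : σ) :
    ∃ q, dlogNum α g s j = C (α a) * pderiv j (g a) * ∏ μ ∈ s.erase a, g μ + g a * q := by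
  refine ⟨dlogNum α g (s.erase a) j, ?_⟩
  conv_lhs => rw [← Finset.insert_erase ha]
  exact dlogNum_insert α g (Finset.notMem_erase a s) j

end dlogNum

end MvPolynomial

/-! ### Bertini's theorem for the pencil `f + c`. -/

namespace MvPolynomial

variable {σ K : Type*} [Field K]

theorem not_dvd_add_C_of_ne {f g : MvPolynomial σ K} (hg : ¬ IsUnit g) {c c' : K} (hcc : c ≠ c')
    (hgc : g ∣ f + C c) : ¬ g ∣ f + C c' := by
  intro h
  have h1 := dvd_sub hgc h
  rw [add_sub_add_left_eq_sub, ← C_sub] at h1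
  exact hg (isUnit_of_dvd_unit h1 ((isUnit_iff_ne_zero.2 (sub_ne_zero.2 hcc)).map C))

/-- Modulo `f + c`, `f` is the constant `-c`. -/
theorem add_C_dvd_aeval_sub (f : MvPolynomial σ K) (c : K) (v : Polynomial K) :
    f + C c ∣ Polynomial.aeval f v - C (v.eval (-c)) := by
  obtain ⟨q, hq⟩ := Polynomial.X_sub_C_dvd_sub_C_eval (p := v) (a := -c)
  refine ⟨Polynomial.aeval f q, ?_⟩
  have := congrArg (Polynomial.aeval f) hq
  simpa [algebraMap_eq] using this

theorem dvd_aeval_iff_eval_eq_zero {f g : MvPolynomial σ K} (hg : ¬ IsUnit g) {c : K}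
    (hgc : g ∣ f + C c) (v : Polynomial K) :
    g ∣ Polynomial.aeval f v ↔ v.eval (-c) = 0 := by
  have h1 := hgc.trans (add_C_dvd_aeval_sub f c v)
  constructor
  · intro h
    by_contra h0
    have h2 := (dvd_sub_right h).1 h1
    exact hg (isUnit_of_dvd_unit h2 ((isUnit_iff_ne_zero.2 h0).map C))
  · intro h
    rwa [h, C_0, sub_zero] at h1

/-- Given factorizations `f + c = g c * h c` of infinitely many members of a pencil, some
nontrivial combination of the logarithmic differentials of the `g c` is proportional to `df`. -/
theorem exists_dlogNum_proportional [Fintype σ] {f : MvPolynomial σ K} {Λ : Set K}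
    (hΛ : Λ.Infinite) {g h : Λ → MvPolynomial σ K} (hgh : ∀ c : Λ, f + C (c : K) = g c * h c)
    (hg : ∀ c, g c ≠ 0) (hh : ∀ c, h c ≠ 0) [DecidableEq Λ] :
    ∃ (s : Finset Λ) (α : Λ → K), (∃ c ∈ s, α c ≠ 0) ∧
      ∀ i j, pderiv i f * dlogNum α g s j = pderiv j f * dlogNum α g s i := by
  -- The components of `dh_c ∧ dg_c`; their degree is at most `2 deg f` for every `c`.
  let k : Λ → σ → σ → MvPolynomial σ K := fun c i j =>
    pderiv i (h c) * pderiv j (g c) - pderiv j (h c) * pderiv i (g c)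
  have hdf : ∀ (c : Λ) i, pderiv i f = g c * pderiv i (h c) + h c * pderiv i (g c) := by
    intro c i
    have := congrArg (pderiv i) (hgh c)
    simpa [Derivation.leibniz] using this
  have hk : ∀ c i j, pderiv i f * pderiv j (g c) - pderiv j f * pderiv i (g c) = k c i j * g c := by
    intro c i j
    rw [hdf c i, hdf c j]
    ring
  let N := f.totalDegree
  have hgd : ∀ c, (g c).totalDegree ≤ N ∧ (h c).totalDegree ≤ N := by
    intro c
    have h1 : (g c).totalDegree + (h c).totalDegree ≤ N := by
      rw [← totalDegree_mul_of_isDomain (hg c) (hh c), ← hgh]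
      refine (totalDegree_add _ _).trans ?_
      simp [N]
    omega
  have hkd : ∀ c i j, k c i j ∈ restrictTotalDegree σ K (N + N) := by
    intro c i j
    rw [mem_restrictTotalDegree]
    have hb : ∀ i j, (pderiv i (h c) * pderiv j (g c)).totalDegree ≤ N + N := fun i j =>
      (totalDegree_mul _ _).trans (add_le_add
        ((totalDegree_pderiv_le _ _).trans (hgd c).2) ((totalDegree_pderiv_le _ _).trans (hgd c).1))
    exact (totalDegree_sub _ _).trans (max_le (hb i j) (hb j i))
  let w : Λ → σ → σ → restrictTotalDegree σ K (N + N) := fun c i j => ⟨k c i j, hkd c i j⟩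
  have hw : ¬ LinearIndependent K w := fun hli => by
    have := hli.finite
    exact hΛ (Set.toFinite Λ)
  obtain ⟨s, α, hsum, hne⟩ := not_linearIndependent_iff.1 hw
  refine ⟨s, α, hne, fun i j => ?_⟩
  have h1 : ∑ c ∈ s, α c • k c i j = 0 := by
    have := congrArg (fun x => ((x i j : restrictTotalDegree σ K (N + N)) : MvPolynomial σ K)) hsum
    simpa [w, Finset.sum_apply] using this
  have h2 := dlogNum_proportional α g (i := i) (j := j) (k := fun c => k c i j) s (fun c => hk c i j)
  rw [h1, zero_mul, sub_eq_zero] at h2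
  exact h2

/-- If the closed form `dlogNum / ∏ g` is proportional to `df`, then it equals `R(f) df` for some
rational function `R`. -/
theorem exists_dlogNum_mul_aeval_eq [CharZero K] [Fintype σ] {f : MvPolynomial σ K} {i₀ : σ}
    (hf : pderiv i₀ f ≠ 0)
    (hcl : ∀ r, IsIntegral (Algebra.adjoin K {f}) r → r ∈ Algebra.adjoin K {f})
    {ι : Type*} [DecidableEq ι] {α : ι → K} {g : ι → MvPolynomial σ K} {s : Finset ι}
    (hg : ∀ c, g c ≠ 0)
    (h : ∀ i j, pderiv i f * dlogNum α g s j = pderiv j f * dlogNum α g s i) :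
    ∃ u v : Polynomial K, IsCoprime u v ∧ ∀ j, dlogNum α g s j * Polynomial.aeval f v =
      pderiv j f * (∏ c ∈ s, g c) * Polynomial.aeval f u := by
  have hP : ∏ c ∈ s, g c ≠ 0 := Finset.prod_ne_zero_iff.2 fun c _ => hg c
  have hb : (∏ c ∈ s, g c) * pderiv i₀ f ≠ 0 := mul_ne_zero hP hf
  -- Here `q` is the `i₀` component of the form divided by `∂f/∂x_{i₀}`; closedness of `q df` says
  -- `dq ∧ df = 0`.
  obtain ⟨u, v, huv, hrel⟩ := exists_isCoprime_of_isAlgebraic_div hcl hb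
    (isAlgebraic_div_of_pderiv_proportional (E := FractionRing (MvPolynomial σ K))
      (a := dlogNum α g s i₀) hf hb fun i => by
      have hc := dlogNum_closed α g s i i₀
      have hr := h i₀ i
      have hdr := congrArg (pderiv i₀) hr
      simp only [Derivation.leibniz, smul_eq_mul] at hdr ⊢
      rw [pderiv_comm i i₀ f]
      linear_combination (pderiv i₀ f) ^ 2 * hc + pderiv i₀ f * (∏ c ∈ s, g c) * hdr
        - (pderiv i₀ f * pderiv i₀ (∏ c ∈ s, g c) + (∏ c ∈ s, g c) * pderiv i₀ (pderiv i₀ f)) * hr)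
  refine ⟨u, v, huv, fun j => mul_left_cancel₀ hf ?_⟩
  linear_combination Polynomial.aeval f v * h i₀ j + pderiv j f * hrel

/-- **Bertini's theorem** for pencils: if `K[f]` is integrally closed in the polynomial ring, then
`f + c` is irreducible for all but finitely many constants `c`. -/
theorem finite_setOf_not_irreducible_add_C [CharZero K] [Fintype σ] {f : MvPolynomial σ K}
    (hf : ∀ c, f ≠ C c)
    (hcl : ∀ r, IsIntegral (Algebra.adjoin K {f}) r → r ∈ Algebra.adjoin K {f}) :
    {c : K | ¬ Irreducible (f + C c)}.Finite := by
  classical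
  obtain ⟨i₀, hi₀⟩ := exists_pderiv_ne_zero hf
  by_contra hinf
  -- Off a finite set of `c`, no irreducible factor of `f + c` divides `df`; in particular `f + c`
  -- is squarefree.
  let Λ : Set K := {c : K | ¬ Irreducible (f + C c)} \
    {c : K | ∃ g, Irreducible g ∧ g ∣ f + C c ∧ ∀ j, g ∣ pderiv j f}
  have hΛ : Λ.Infinite := Set.Infinite.sdiff hinf (finite_setOf_irreducible_dvd_pderiv hi₀)
  have hgood : ∀ (c : Λ) g, Irreducible g → g ∣ f + C (c : K) → ∃ j, ¬ g ∣ pderiv j f := by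
    intro c g hg hgc
    by_contra! hall
    exact c.2.2 ⟨g, hg, hgc, hall⟩
  have hne : ∀ c : K, f + C c ≠ 0 := fun c h =>
    hf (-c) (by rw [C_neg]; exact eq_neg_of_add_eq_zero_left h)
  have hfac : ∀ c : Λ, ∃ g h, ¬ IsUnit g ∧ ¬ IsUnit h ∧ f + C (c : K) = g * h := by
    intro c
    have hirr := c.2.1
    have hnu : ¬ IsUnit (f + C (c : K)) := by
      intro hu
      obtain ⟨b, -, hb⟩ := isUnit_iff_eq_C_of_isReduced.1 hu
      exact hf (b - c) (by rw [C_sub, ← hb]; ring)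
    have hirr' : ¬ Irreducible (f + C (c : K)) := hirr
    rw [irreducible_iff] at hirr'
    push Not at hirr'
    obtain ⟨g, h, hgh, hg, hh⟩ := hirr' hnu
    exact ⟨g, h, hg, hh, hgh⟩
  choose g h hgu hhu hgh using hfac
  have hg0 : ∀ c, g c ≠ 0 := fun c h0 => hne c (by rw [hgh, h0, zero_mul])
  have hh0 : ∀ c, h c ≠ 0 := fun c h0 => hne c (by rw [hgh, h0, mul_zero])
  obtain ⟨s, α, ⟨a, has, hαa⟩, hprop⟩ := exists_dlogNum_proportional hΛ hgh hg0 hh0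
  obtain ⟨u, v, huv, hrel⟩ := exists_dlogNum_mul_aeval_eq hi₀ hcl hg0 hprop
  have hdf : ∀ (c : Λ) i, pderiv i f = g c * pderiv i (h c) + h c * pderiv i (g c) := by
    intro c i
    have := congrArg (pderiv i) (hgh c)
    simpa [Derivation.leibniz] using this
  have hcop : ∀ q, Irreducible q → q ∣ f + C (a : K) → ¬ q ∣ ∏ c ∈ s.erase a, g c := by
    intro q hq hqa hdvd
    obtain ⟨c, hc, hqc⟩ := (hq.prime.dvd_finsetProd_iff _).1 hdvd
    have hca : (a : K) ≠ c := fun h => Finset.ne_of_mem_erase hc (Subtype.ext h.symm)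
    exact not_dvd_add_C_of_ne hq.not_isUnit hca hqa
      (hqc.trans (hgh c ▸ dvd_mul_right _ _))
  -- If `v(-a) = 0`, then `u(f) / v(f)` has a pole along a factor `q` of `h a`, where the form has
  -- none. Otherwise it has no pole along a factor `q` of `g a`, where the form has residue `α a ≠
  -- 0`.
  by_cases hv : v.eval (-(a : K)) = 0
  · obtain ⟨q, hq, hqh⟩ := WfDvdMonoid.exists_irreducible_factor (hhu a) (hh0 a)
    have hqa : q ∣ f + C (a : K) := hqh.trans (hgh a ▸ dvd_mul_left _ _)
    obtain ⟨j, hj⟩ := hgood a q hq hqa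
    have hqv := (dvd_aeval_iff_eval_eq_zero hq.not_isUnit hqa v).2 hv
    have hqu : ¬ q ∣ Polynomial.aeval f u := by
      rw [dvd_aeval_iff_eval_eq_zero hq.not_isUnit hqa]
      intro hu
      obtain ⟨x, y, hxy⟩ := huv
      have := congrArg (Polynomial.eval (-(a : K))) hxy
      simp [hu, hv] at this
    have h1 : q ∣ pderiv j f * (∏ c ∈ s, g c) * Polynomial.aeval f u :=
      hrel j ▸ hqv.mul_left _
    rw [← Finset.mul_prod_erase s g has] at h1
    rcases hq.prime.dvd_or_dvd h1 with h2 | h2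
    · rcases hq.prime.dvd_or_dvd h2 with h3 | h3
      · exact hj h3
      · rcases hq.prime.dvd_or_dvd h3 with h4 | h4
        · exact hj (hdf a j ▸ dvd_add (h4.mul_right _) (hqh.mul_right _))
        · exact hcop q hq hqa h4
    · exact hqu h2
  · obtain ⟨q, hq, hqg⟩ := WfDvdMonoid.exists_irreducible_factor (hgu a) (hg0 a)
    have hqa : q ∣ f + C (a : K) := hqg.trans (hgh a ▸ dvd_mul_right _ _)
    obtain ⟨j, hj⟩ := hgood a q hq hqa
    have hqv : ¬ q ∣ Polynomial.aeval f v := fun h1 =>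
      hv ((dvd_aeval_iff_eval_eq_zero hq.not_isUnit hqa v).1 h1)
    have h1 : q ∣ dlogNum α g s j * Polynomial.aeval f v := by
      rw [hrel j, ← Finset.mul_prod_erase s g has]
      exact ((hqg.mul_right _).mul_left _).mul_right _
    have h2 := (hq.prime.dvd_or_dvd h1).resolve_right hqv
    obtain ⟨r, hr⟩ := exists_dlogNum_eq α g has j
    rw [hr, dvd_add_left (hqg.mul_right _)] at h2
    have h3 := (hq.prime.dvd_or_dvd h2).resolve_right (hcop q hq hqa)
    have h4 : q ∣ pderiv j (g a) := by
      rcases hq.prime.dvd_or_dvd h3 with h4 | h4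
      · exact absurd (isUnit_of_dvd_unit h4 ((isUnit_iff_ne_zero.2 hαa).map C)) hq.not_isUnit
      · exact h4
    exact hj (hdf a j ▸ dvd_add (hqg.mul_right _) (h4.mul_left _))

end MvPolynomial

/-! ### The theorem. -/

theorem theorem4 {K : Type*} [Field K] [IsAlgClosed K] [CharZero K] (n k : ℕ)
    (p : Fin k → MvPolynomial (Fin n) K) (m : Fin k → ℕ)
    (hirr : ∀ i, Irreducible (p i))
    (hind : AlgebraicIndependent K p)
    (hgcd : Finset.univ.gcd m = 1) :
    {c : K | ¬ Irreducible ((∏ i, p i ^ m i) + MvPolynomial.C c)}.Finite := by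
  have hf : ∀ c, ∏ i, p i ^ m i ≠ MvPolynomial.C c := by
    intro c hc
    obtain ⟨i, hi⟩ : ∃ i, m i ≠ 0 := by
      by_contra! h0
      have : Finset.univ.gcd m = 0 := Finset.gcd_eq_zero_iff.2 fun i _ => h0 i
      omega
    have hdvd : p i ∣ MvPolynomial.C c :=
      hc ▸ (dvd_pow_self (p i) hi).trans (Finset.dvd_prod_of_mem _ (Finset.mem_univ i))
    have hc0 : c ≠ 0 := by
      rintro rfl
      rw [MvPolynomial.C_0, Finset.prod_eq_zero_iff] at hc
      obtain ⟨j, -, hj⟩ := hc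
      exact (hirr j).ne_zero (eq_zero_of_pow_eq_zero hj)
    exact (hirr i).not_isUnit
      (isUnit_of_dvd_unit hdvd ((isUnit_iff_ne_zero.2 hc0).map MvPolynomial.C))
  exact MvPolynomial.finite_setOf_not_irreducible_add_C hf fun r hr =>
    MvPolynomial.mem_adjoin_of_isIntegral_adjoin_prod_pow hirr hind hgcd hf hr
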